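/- **Setup (max-min grouped bandits).** There are $n$ arms $\{1,\dots,n\}$ and a known finite collection $\mathcal G$ of non-empty, possibly overlapping subsets (groups) of the arms, such that every arm is in at least one group. For each arm $j$, its successive rewards $X_{j,1},X_{j,2},\dots$ are drawn independently from a distribution with mean $\mu_j\in[0,1]$ that is sub-Gaussian with parameter $R\le\frac12$, i.e. $\mathbb E[e^{\lambda(X_{j,1}-\mu_j)}]\le e^{\lambda^2R^2/2}$ for all $\lambda\in\mathbb R$. Suppose that the max-min optimal group is unique: there is $G^*\in\mathcal G$ with $\min_{j\in G^*}\mu_j>\min_{j\in G}\mu_j$ for all $G\in\mathcal G$, $G\ne G^*$. Put $\Delta_G=\min_{i\in G^*}\mu_i-\min_{i\in G}\mu_i$ and, for each arm $j$, $$\Delta_j=\max\{\Delta_j',\Delta_j'',\Delta_0\},\quad \Delta_j'=\min_{G\ni j}\Big(\mu_j-\min_{i\in G}\mu_i\Big),\quad \Delta_j''=\min_{G\ni j}\Delta_G,\quad \Delta_0=\min_{G\neq G^*}\Delta_G$$ (with $\Delta_0=+\infty$ if $G^*$ is the only group). **Algorithm (StableOpt variant with parameters $\varepsilon\in(0,1)$,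 $\delta$, $T$).** Let $T_j(t)$ be the number of pulls of arm $j$ in rounds $1,\dots,t$, let $\hat\mu_{j,k}=\frac1k\sum_{s=1}^kX_{j,s}$, and let $$U(k,\delta)=(1+\sqrt\varepsilon)\sqrt{\frac{1+\varepsilon}{2k}\log\frac{\log((1+\varepsilon)k)}{\delta}} .$$ If $T_j(t)\ge1$, let $\mathrm{UCB}_t(j)=\hat\mu_{j,T_j(t)}+U(T_j(t),\frac{\delta}{n})$ and $\mathrm{LCB}_t(j)=\hat\mu_{j,T_j(t)}-U(T_j(t),\frac{\delta}{n})$; if $T_j(t)=0$, let $\mathrm{UCB}_t(j)=1$ and $\mathrm{LCB}_t(j)=0$. In each round $t=1,\dots,T$ the algorithm picks $G_t\in\arg\max_{G\in\mathcal G}\min_{j\in G}\mathrm{UCB}_{t-1}(j)$ and pulls an arm $j_t\in\arg\min_{j\in G_t}\mathrm{LCB}_{t-1}(j)$. After $T$ rounds it outputs $G^{(T)}=G_{t^*}$ with $t^*\in\arg\max_{1\le t\le T}\min_{j\in G_t}\mathrm{LCB}_{t-1}(j)$. All ties are broken arbitrarily. **Statement.** For every fixed $\varepsilon\in(0,1)$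 there are constants $C,c>0$, depending only on $\varepsilon$, such that the following holds for every instance as above, every $\delta\in\big(0,\frac{\log 2}{e}\big)$ and every $\Delta_{\min}>0$ with $\Delta_j\ge\Delta_{\min}$ for all $j=1,\dots,n$: if $$T\ \ge\ c\,A\,\max\{1,\log\log A\},\qquad A=\frac{n\log\frac n\delta}{\Delta_{\min}^2}$$ (where the maximum is read as $1$ if $A\le e$), then $\mathbb P[G^{(T)}\ne G^*]\le C\delta$; that is, with probability at least $1-C\delta$ the algorithm outputs exactly $G^*$. -/

import Mathlib

open MeasureTheory ProbabilityTheory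
open scoped NNReal

/-- A max-min grouped bandit instance with arms `Fin n`: a finite collection of non-empty, possibly
overlapping groups covering all arms, and a reward distribution for each arm. -/
structure GroupedBandit (n : ℕ) where
  /-- the known set of groups -/
  groups : Finset (Finset (Fin n))
  nonempty_of_mem : ∀ {G : Finset (Fin n)}, G ∈ groups → G.Nonempty
  covers : ∀ j : Fin n, ∃ G ∈ groups, j ∈ G
  /-- the reward distribution of each arm -/
  law : Fin n → Measure ℝ
  isProbabilityMeasure_law : ∀ j, IsProbabilityMeasure (law j)

namespace GroupedBandit

variable {n : ℕ}

/-- The groups of the instance, as a type. -/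
abbrev Group (I : GroupedBandit n) : Type := {G : Finset (Fin n) // G ∈ I.groups}

/-- The mean reward of an arm. -/
noncomputable def mean (I : GroupedBandit n) (j : Fin n) : ℝ := ∫ x, x ∂(I.law j)

/-- `min_{j ∈ G} f j`. -/
noncomputable def groupMin (I : GroupedBandit n) (f : Fin n → ℝ) (G : I.Group) : ℝ :=
  G.1.inf' (I.nonempty_of_mem G.2) f

/-- The mean of the worst arm of a group. -/
noncomputable def worstMean (I : GroupedBandit n) (G : I.Group) : ℝ := I.groupMin I.mean G

/-- Means lie in `[0,1]`, and each reward distribution is sub-Gaussian with parameter `R`: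
`E[exp (s (X - mean))] ≤ exp (s² R² / 2)` for all real `s`. -/
structure BoundedSubGaussian (I : GroupedBandit n) (R : ℝ≥0) : Prop where
  mean_mem : ∀ j, I.mean j ∈ Set.Icc (0 : ℝ) 1
  subGaussian : ∀ j, HasSubgaussianMGF (fun x : ℝ => x - I.mean j) (R ^ 2) (I.law j)

/-- `Gstar` is the unique group with the highest worst arm. -/
def IsUniqueOptimal (I : GroupedBandit n) (Gstar : I.Group) : Prop :=
  ∀ G : I.Group, G ≠ Gstar → I.worstMean G < I.worstMean Gstar

/-! ### Gaps

All minima are over finite sets and are taken in `EReal`, so that a minimum over the empty set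
(which occurs only for `gapZero`, when there is just one group) is `+∞`. -/

/-- The gap `Δ_G` of a group. -/
noncomputable def groupGap (I : GroupedBandit n) (Gstar G : I.Group) : ℝ :=
  I.worstMean Gstar - I.worstMean G

/-- `Δ'_j`: the minimum of `mean j - worstMean G` over the groups `G` containing `j`. -/
noncomputable def gapOne (I : GroupedBandit n) (j : Fin n) : EReal :=
  ⨅ G : {G : I.Group // j ∈ G.1}, ((I.mean j - I.worstMean G.1 : ℝ) : EReal)

/-- `Δ''_j`: the minimum of `Δ_G` over the groups `G` containing `j`. -/
noncomputable def gapTwo (I : GroupedBandit n) (Gstar : I.Group) (j : Fin n) : EReal :=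
  ⨅ G : {G : I.Group // j ∈ G.1}, ((I.groupGap Gstar G.1 : ℝ) : EReal)

/-- `Δ_0`: the minimum of `Δ_G` over the groups `G ≠ Gstar`. -/
noncomputable def gapZero (I : GroupedBandit n) (Gstar : I.Group) : EReal :=
  ⨅ G : {G : I.Group // G ≠ Gstar}, ((I.groupGap Gstar G.1 : ℝ) : EReal)

/-- The overall gap `Δ_j = max {Δ'_j, Δ''_j, Δ_0}` of an arm. -/
noncomputable def gap (I : GroupedBandit n) (Gstar : I.Group) (j : Fin n) : EReal :=
  max (max (I.gapOne j) (I.gapTwo Gstar j)) (I.gapZero Gstar)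

/-! ### Confidence bounds

`x j s` denotes the reward of the `(s+1)`-th pull of arm `j`, and `a t` the arm pulled in round
`t`, where rounds are numbered `1, 2, …`. -/

/-- The number of pulls of arm `j` in rounds `1, …, t`. -/
def pulls (a : ℕ → Fin n) (t : ℕ) (j : Fin n) : ℕ :=
  ((Finset.Icc 1 t).filter (fun s => a s = j)).card

/-- The empirical mean of the first `k` rewards of arm `j`. -/
noncomputable def empMean (x : Fin n → ℕ → ℝ) (j : Fin n) (k : ℕ) : ℝ :=
  (∑ s ∈ Finset.range k, x j s) / (k : ℝ)

/-- The confidence width after `k ≥ 1` pulls,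
`U(k, δ) = (1 + √ε) √((1 + ε)/(2k) · log (log ((1 + ε) k) / δ))`. -/
noncomputable def confWidth (ε : ℝ) (k : ℕ) (δ : ℝ) : ℝ :=
  (1 + √ε) * √((1 + ε) / (2 * (k : ℝ)) * Real.log (Real.log ((1 + ε) * (k : ℝ)) / δ))

/-- `UCB_t(j)`, equal to `1` as long as arm `j` has not been pulled. -/
noncomputable def ucb (ε δ : ℝ) (x : Fin n → ℕ → ℝ) (a : ℕ → Fin n) (t : ℕ) (j : Fin n) : ℝ :=
  if pulls a t j = 0 then 1
  else empMean x j (pulls a t j) + confWidth ε (pulls a t j) (δ / (n : ℝ))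

/-- `LCB_t(j)`, equal to `0` as long as arm `j` has not been pulled. -/
noncomputable def lcb (ε δ : ℝ) (x : Fin n → ℕ → ℝ) (a : ℕ → Fin n) (t : ℕ) (j : Fin n) : ℝ :=
  if pulls a t j = 0 then 0
  else empMean x j (pulls a t j) - confWidth ε (pulls a t j) (δ / (n : ℝ))

/-! ### The algorithm -/

/-- On the reward table `x`, the groups `g t` and arms `a t`, `t = 1, …, T`, are chosen by
the StableOpt rule `g t ∈ argmax_G min_{j ∈ G} UCB_{t-1}(j)` and
`a t ∈ argmin_{j ∈ g t} LCB_{t-1}(j)`, with ties broken in any way. -/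
structure IsStableOptRun (I : GroupedBandit n) (ε δ : ℝ) (x : Fin n → ℕ → ℝ) (T : ℕ)
    (g : ℕ → I.Group) (a : ℕ → Fin n) : Prop where
  group_argmax : ∀ t ∈ Finset.Icc 1 T, ∀ H : I.Group,
    I.groupMin (ucb ε δ x a (t - 1)) H ≤ I.groupMin (ucb ε δ x a (t - 1)) (g t)
  arm_mem : ∀ t ∈ Finset.Icc 1 T, a t ∈ (g t).1
  arm_argmin : ∀ t ∈ Finset.Icc 1 T, ∀ j ∈ (g t).1,
    lcb ε δ x a (t - 1) (a t) ≤ lcb ε δ x a (t - 1) j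

/-- `G` is a possible output of StableOpt after `T` rounds on the reward table `x` (there may be
several, according to how ties are broken): `G = g t*` for a run `(g, a)`, where
`t* ∈ argmax_{1 ≤ t ≤ T} min_{j ∈ g t} LCB_{t-1}(j)`. -/
def IsStableOptOutput (I : GroupedBandit n) (ε δ : ℝ) (x : Fin n → ℕ → ℝ) (T : ℕ)
    (G : I.Group) : Prop :=
  ∃ (g : ℕ → I.Group) (a : ℕ → Fin n), I.IsStableOptRun ε δ x T g a ∧
    ∃ tstar ∈ Finset.Icc 1 T,
      (∀ t ∈ Finset.Icc 1 T, I.groupMin (lcb ε δ x a (t - 1)) (g t) ≤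
        I.groupMin (lcb ε δ x a (tstar - 1)) (g tstar)) ∧
      G = g tstar

/-- `X j s`, `s = 0, 1, …`, are the successive rewards of arm `j`: for each arm, independent draws
from its reward distribution. -/
structure IsRewardTable (I : GroupedBandit n) {Ω : Type*} [MeasurableSpace Ω] (P : Measure Ω)
    (X : Fin n → ℕ → Ω → ℝ) : Prop where
  hasLaw : ∀ j s, HasLaw (X j s) (I.law j) P
  indep : ∀ j, iIndepFun (X j) P

end GroupedBandit

/-- `A · max (1, log log A)`, written so that the factor is `1` for `0 < A ≤ exp (exp 1)`. -/
noncomputable def mulLogLog (A : ℝ) : ℝ :=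
  A * Real.log (max (Real.exp 1) (Real.log A))

namespace ProbabilityTheory

variable {Ω : Type*} [MeasurableSpace Ω] {P : Measure Ω}

lemma one_le_integral_exp_of_integral_eq_zero [IsProbabilityMeasure P] {Y : Ω → ℝ}
    (hY : Integrable Y P) (hmean : ∫ ω, Y ω ∂P = 0) {l : ℝ}
    (hexp : Integrable (fun ω => Real.exp (l * Y ω)) P) :
    1 ≤ ∫ ω, Real.exp (l * Y ω) ∂P := by
  have h1 : ∫ ω, (l * Y ω + 1) ∂P = 1 := by
    rw [integral_add (hY.const_mul l) (integrable_const _), integral_const_mul, hmean]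
    simp
  rw [← h1]
  exact integral_mono ((hY.const_mul l).add (integrable_const _)) hexp
    fun ω => Real.add_one_le_exp _

/-- The exponentials of the partial sums of independent centred variables with finite exponential
moments form a submartingale. -/
lemma iIndepFun.submartingale_exp_mul_sum {Y : ℕ → Ω → ℝ}
    [IsProbabilityMeasure P] (hindep : iIndepFun Y P) (hmeas : ∀ i, Measurable (Y i)) {l : ℝ}
    (hexp : ∀ i, Integrable (fun ω => Real.exp (l * Y i ω)) P) (hY : ∀ i, Integrable (Y i) P)
    (hmean : ∀ i, ∫ ω, Y i ω ∂P = 0) :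
    Submartingale (fun k ω => Real.exp (l * (∑ i ∈ Finset.range (k + 1), Y i) ω))
      (Filtration.natural Y fun i => (hmeas i).stronglyMeasurable) P := by
  have hadp : StronglyAdapted (Filtration.natural Y fun i => (hmeas i).stronglyMeasurable)
      (fun k ω => Real.exp (l * (∑ i ∈ Finset.range (k + 1), Y i) ω)) := by
    intro k
    refine Real.continuous_exp.comp_stronglyMeasurable (StronglyMeasurable.const_mul ?_ l)
    refine Finset.stronglyMeasurable_sum _ fun i hi => ?_
    exact (Filtration.stronglyAdapted_natural (fun i => (hmeas i).stronglyMeasurable) i).mono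
      ((Filtration.natural Y fun i => (hmeas i).stronglyMeasurable).mono
        (Nat.lt_succ_iff.mp (Finset.mem_range.mp hi)))
  have hint : ∀ k, Integrable
      (fun ω => Real.exp (l * (∑ i ∈ Finset.range (k + 1), Y i) ω)) P := fun k =>
    hindep.integrable_exp_mul_sum hmeas fun i _ => hexp i
  refine submartingale_nat hadp hint fun k => ?_
  have hsplit : (fun ω => Real.exp (l * (∑ i ∈ Finset.range (k + 1 + 1), Y i) ω)) =
      (fun ω => Real.exp (l * (∑ i ∈ Finset.range (k + 1), Y i) ω)) *
        (fun ω => Real.exp (l * Y (k + 1) ω)) := by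
    funext ω
    rw [Finset.sum_range_succ, Pi.mul_apply, ← Real.exp_add, Pi.add_apply, mul_add]
  have h1 := condExp_mul_of_stronglyMeasurable_left (μ := P) (hadp k)
    (by rw [← hsplit]; exact hint (k + 1)) (hexp (k + 1))
  have h2 := condExp_indep_eq (μ := P) (hmeas (k + 1)).comap_le
    ((Filtration.natural Y fun i => (hmeas i).stronglyMeasurable).le k)
    (f := fun ω => Real.exp (l * Y (k + 1) ω))
    (Real.continuous_exp.comp_stronglyMeasurable
      ((comap_measurable (Y (k + 1))).stronglyMeasurable.const_mul l))
    (hindep.indep_comap_natural_of_lt _ (Nat.lt_succ_self k))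
  rw [← hsplit] at h1
  filter_upwards [h1, h2] with ω h1 h2
  rw [h1, Pi.mul_apply, h2]
  exact le_mul_of_one_le_right (Real.exp_pos _).le
    (one_le_integral_exp_of_integral_eq_zero (hY _) (hmean _) (hexp _))

/-- Maximal version of the Chernoff bound for sums of independent sub-Gaussian variables. -/
lemma HasSubgaussianMGF.measure_exists_sum_range_ge_le_of_measurable {Y : ℕ → Ω → ℝ}
    [IsProbabilityMeasure P] (hindep : iIndepFun Y P) (hmeas : ∀ i, Measurable (Y i)) {c : ℝ≥0}
    (hc : 0 < c) (hsub : ∀ i, HasSubgaussianMGF (Y i) c P) (hmean : ∀ i, ∫ ω, Y i ω ∂P = 0)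
    {x : ℝ} (hx : 0 ≤ x) (m : ℕ) :
    P.real {ω | ∃ k ∈ Finset.Icc 1 m, x ≤ ∑ i ∈ Finset.range k, Y i ω} ≤
      Real.exp (-x ^ 2 / (2 * m * c)) := by
  obtain _ | m := m
  · simp
  have hc' : (0 : ℝ) < c := hc
  set M : ℝ := ((m + 1 : ℕ) : ℝ) with hM
  have hMpos : 0 < M := by positivity
  set l : ℝ := x / (M * c) with hl
  have hl0 : 0 ≤ l := by positivity
  set a : ℝ≥0 := ⟨Real.exp (l * x), (Real.exp_pos _).le⟩ with ha
  have ha' : (a : ℝ) = Real.exp (l * x) := rfl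
  have hsubm := hindep.submartingale_exp_mul_sum hmeas (l := l)
    (fun i => (hsub i).integrable_exp_mul l) (fun i => (hsub i).integrable) hmean
  have hmax := maximal_ineq hsubm (fun k ω => (Real.exp_pos _).le) (ε := a) m
  set B := {ω | (a : ℝ) ≤ (Finset.range (m + 1)).sup' Finset.nonempty_range_add_one
    fun k => Real.exp (l * (∑ i ∈ Finset.range (k + 1), Y i) ω)} with hB
  have hint := hindep.integrable_exp_mul_sum (t := l) hmeas (s := Finset.range (m + 1))
    fun i _ => (hsub i).integrable_exp_mul l
  have hle : ∫ ω in B, Real.exp (l * (∑ i ∈ Finset.range (m + 1), Y i) ω) ∂P ≤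
      Real.exp (M * (c * l ^ 2 / 2)) := by
    refine (setIntegral_le_integral hint (ae_of_all _ fun ω => (Real.exp_pos _).le)).trans ?_
    change mgf (∑ i ∈ Finset.range (m + 1), Y i) P l ≤ _
    rw [hindep.mgf_sum hmeas]
    refine (Finset.prod_le_prod (fun i _ => mgf_nonneg) fun i _ => (hsub i).mgf_le l).trans ?_
    rw [Finset.prod_const, Finset.card_range, ← Real.exp_nat_mul]
  have hreal : Real.exp (l * x) * P.real B ≤ Real.exp (M * (c * l ^ 2 / 2)) := by
    have := ENNReal.toReal_mono ENNReal.ofReal_ne_top hmax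
    rw [ENNReal.toReal_mul, ENNReal.toReal_ofReal
      (setIntegral_nonneg_of_ae (ae_of_all _ fun ω => (Real.exp_pos _).le))] at this
    exact this.trans hle
  have hsubset : {ω | ∃ k ∈ Finset.Icc 1 (m + 1), x ≤ ∑ i ∈ Finset.range k, Y i ω} ⊆ B := by
    rintro ω ⟨k, hk, hxk⟩
    rw [Finset.mem_Icc] at hk
    have hmem : k - 1 ∈ Finset.range (m + 1) := Finset.mem_range.mpr (by omega)
    refine le_trans ?_ (Finset.le_sup'
      (fun k => Real.exp (l * (∑ i ∈ Finset.range (k + 1), Y i) ω)) hmem)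
    rw [ha', Nat.sub_add_cancel hk.1, Finset.sum_apply]
    exact Real.exp_le_exp.mpr (mul_le_mul_of_nonneg_left hxk hl0)
  refine (measureReal_mono hsubset).trans ?_
  have : P.real B ≤ Real.exp (M * (c * l ^ 2 / 2)) / Real.exp (l * x) := by
    rw [le_div_iff₀ (Real.exp_pos _), mul_comm]
    exact hreal
  refine this.trans_eq ?_
  rw [← Real.exp_sub]
  congr 1
  rw [hl]
  field_simp
  ring

/-- Maximal version of the Chernoff bound for sums of independent sub-Gaussian variables. -/
lemma HasSubgaussianMGF.measure_exists_sum_range_ge_le {Y : ℕ → Ω → ℝ}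
    [IsProbabilityMeasure P] (hindep : iIndepFun Y P) {c : ℝ≥0}
    (hc : 0 < c) (hsub : ∀ i, HasSubgaussianMGF (Y i) c P) (hmean : ∀ i, ∫ ω, Y i ω ∂P = 0)
    {x : ℝ} (hx : 0 ≤ x) (m : ℕ) :
    P.real {ω | ∃ k ∈ Finset.Icc 1 m, x ≤ ∑ i ∈ Finset.range k, Y i ω} ≤
      Real.exp (-x ^ 2 / (2 * m * c)) := by
  have hmk := fun i => (hsub i).aemeasurable.ae_eq_mk
  refine le_of_eq_of_le ?_ (measure_exists_sum_range_ge_le_of_measurable (hindep.congr hmk)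
    (fun i => (hsub i).aemeasurable.measurable_mk) hc (fun i => (hsub i).congr (hmk i))
    (fun i => (integral_congr_ae (hmk i)).symm.trans (hmean i)) hx m)
  refine measureReal_congr ?_
  filter_upwards [ae_all_iff.mpr hmk] with ω hω
  refine propext (?_ : (∃ k ∈ Finset.Icc 1 m, x ≤ ∑ i ∈ Finset.range k, Y i ω) ↔
    ∃ k ∈ Finset.Icc 1 m, x ≤ ∑ i ∈ Finset.range k, (hsub i).aemeasurable.mk (Y i) ω)
  simp only [hω]

end ProbabilityTheory

namespace GroupedBandit

/-- Lower bound for `k * confWidth ε k d` on the block `(1 + √ε)^(2i) ≤ k < (1 + √ε)^(2i+2)`. -/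
noncomputable def blockLevel (ε d : ℝ) (i : ℕ) : ℝ :=
  (1 + √ε) * √((1 + ε) / 2 * ((1 + √ε) ^ 2) ^ i * Real.log ((i + 1) * Real.log (1 + ε) / d))

lemma one_lt_one_add_sqrt_sq {ε : ℝ} (hε : 0 < ε) : 1 < (1 + √ε) ^ 2 :=
  one_lt_pow₀ (by linarith [Real.sqrt_pos.mpr hε]) two_ne_zero

lemma one_le_block_ratio {ε d : ℝ} (hd : 0 < d) (hdε : d ≤ Real.log (1 + ε)) (i : ℕ) :
    1 ≤ ((i : ℝ) + 1) * Real.log (1 + ε) / d := by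
  rw [le_div_iff₀ hd, one_mul]
  have : (0 : ℝ) ≤ i := i.cast_nonneg
  nlinarith

lemma log_block_le {ε : ℝ} (hε : 0 < ε) {k i : ℕ} (hi : ((1 + √ε) ^ 2) ^ i ≤ (k : ℝ)) :
    ((i : ℝ) + 1) * Real.log (1 + ε) ≤ Real.log ((1 + ε) * k) := by
  have h1 : (1 + ε) ≤ (1 + √ε) ^ 2 := by
    nlinarith [Real.sq_sqrt hε.le, Real.sqrt_nonneg ε]
  have h2 : (1 + ε) ^ (i + 1) ≤ (1 + ε) * k := by
    rw [pow_succ']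
    have : (1 + ε) ^ i ≤ ((1 + √ε) ^ 2) ^ i := pow_le_pow_left₀ (by linarith) h1 i
    gcongr
    exact this.trans hi
  have h3 := Real.log_le_log (by positivity) h2
  rw [Real.log_pow] at h3
  exact_mod_cast h3

lemma blockLevel_le {ε d : ℝ} (hε : 0 < ε) (hd : 0 < d) (hdε : d ≤ Real.log (1 + ε))
    {k i : ℕ} (hk : 1 ≤ k) (hi : ((1 + √ε) ^ 2) ^ i ≤ (k : ℝ)) :
    blockLevel ε d i ≤ k * confWidth ε k d := by
  have hk0 : (0 : ℝ) < k := by exact_mod_cast hk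
  rw [blockLevel, confWidth, mul_left_comm]
  refine mul_le_mul_of_nonneg_left ?_ (by positivity)
  have h1 : (k : ℝ) * √((1 + ε) / (2 * k) * Real.log (Real.log ((1 + ε) * k) / d)) =
      √((1 + ε) / 2 * k * Real.log (Real.log ((1 + ε) * k) / d)) := by
    rw [← Real.sqrt_sq hk0.le, ← Real.sqrt_mul (sq_nonneg _), Real.sqrt_sq hk0.le]
    congr 1
    field_simp
  rw [h1]
  refine Real.sqrt_le_sqrt ?_
  have hr := one_le_block_ratio hd hdε i
  have h0 : 0 ≤ Real.log (((i : ℝ) + 1) * Real.log (1 + ε) / d) := Real.log_nonneg hr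
  have h2 : Real.log (((i : ℝ) + 1) * Real.log (1 + ε) / d) ≤
      Real.log (Real.log ((1 + ε) * k) / d) :=
    Real.log_le_log (by linarith) (by gcongr; exact log_block_le hε hi)
  gcongr

/-- The probability that the sums of independent centred variables, sub-Gaussian with parameter
`1 / 2`, ever exceed the confidence width. -/
lemma measure_exists_confWidth_le {Ω : Type*} [MeasurableSpace Ω] {P : Measure Ω}
    [IsProbabilityMeasure P] {ε d : ℝ} (hε : 0 < ε) (hd : 0 < d) (hdε : d ≤ Real.log (1 + ε))
    {Y : ℕ → Ω → ℝ} (hindep : iIndepFun Y P)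
    (hsub : ∀ i, HasSubgaussianMGF (Y i) (1 / 4) P) (hmean : ∀ i, ∫ ω, Y i ω ∂P = 0) :
    P.real {ω | ∃ k : ℕ, 1 ≤ k ∧ k * confWidth ε k d ≤ ∑ s ∈ Finset.range k, Y s ω} ≤
      d / Real.log (1 + ε) * ∑' i : ℕ, 1 / ((i : ℝ) + 1) ^ (1 + ε) := by
  have hq := one_lt_one_add_sqrt_sq hε
  set q := (1 + √ε) ^ 2 with hqdef
  have ha : 0 < Real.log (1 + ε) := hd.trans_le hdε
  set B : ℕ → Set Ω := fun i => {ω | ∃ k ∈ Finset.Icc 1 ⌊q ^ (i + 1)⌋₊,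
    blockLevel ε d i ≤ ∑ s ∈ Finset.range k, Y s ω} with hB
  set b : ℕ → ℝ := fun i => d / Real.log (1 + ε) * (1 / ((i : ℝ) + 1) ^ (1 + ε)) with hb
  have hb0 : ∀ i, 0 ≤ b i := fun i => by positivity
  have hsum : Summable b := by
    have h := (summable_nat_add_iff 1).mpr (Real.summable_one_div_nat_rpow.mpr
      (show 1 < 1 + ε by linarith))
    refine Summable.mul_left _ ?_
    simpa using h
  have hBle : ∀ i, P (B i) ≤ ENNReal.ofReal (b i) := by
    intro i
    rw [← ENNReal.ofReal_toReal (measure_ne_top P (B i))]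
    refine ENNReal.ofReal_le_ofReal ?_
    refine (HasSubgaussianMGF.measure_exists_sum_range_ge_le hindep (by norm_num) hsub hmean
      (by unfold blockLevel; positivity) _).trans ?_
    have hr := one_le_block_ratio hd hdε i
    set ρ := ((i : ℝ) + 1) * Real.log (1 + ε) / d with hρ
    have hlog : 0 ≤ Real.log ρ := Real.log_nonneg hr
    have hm : (1 : ℝ) ≤ ⌊q ^ (i + 1)⌋₊ := by
      exact_mod_cast Nat.le_floor (by exact_mod_cast one_le_pow₀ hq.le)
    have hmq : (⌊q ^ (i + 1)⌋₊ : ℝ) ≤ q ^ (i + 1) := Nat.floor_le (by positivity)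
    have hsq : blockLevel ε d i ^ 2 = q ^ (i + 1) * ((1 + ε) / 2 * Real.log ρ) := by
      rw [blockLevel, mul_pow, Real.sq_sqrt (by positivity), pow_succ]
      ring
    have h1 : Real.exp (-blockLevel ε d i ^ 2 / (2 * ⌊q ^ (i + 1)⌋₊ * ((1 / 4 : ℝ≥0) : ℝ))) ≤
        Real.exp (Real.log ρ * (-(1 + ε))) := by
      refine Real.exp_le_exp.mpr ?_
      rw [neg_div, mul_neg, neg_le_neg_iff, hsq, le_div_iff₀ (by push_cast; linarith)]
      have : Real.log ρ * (1 + ε) * (2 * ⌊q ^ (i + 1)⌋₊ * ((1 / 4 : ℝ≥0) : ℝ)) =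
          ⌊q ^ (i + 1)⌋₊ * ((1 + ε) / 2 * Real.log ρ) := by
        push_cast
        ring
      rw [this]
      exact mul_le_mul_of_nonneg_right hmq (by positivity)
    refine h1.trans ?_
    rw [← Real.rpow_def_of_pos (by linarith), Real.rpow_neg (by linarith)]
    have h2 : ρ ^ (1 + ε) = ((i : ℝ) + 1) ^ (1 + ε) * (Real.log (1 + ε) / d) ^ (1 + ε) := by
      rw [hρ, mul_div_assoc, Real.mul_rpow (by positivity) (by positivity)]
    have h3 : Real.log (1 + ε) / d ≤ (Real.log (1 + ε) / d) ^ (1 + ε) :=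
      Real.self_le_rpow_of_one_le ((one_le_div hd).mpr hdε) (by linarith)
    rw [h2, hb]
    have h4 : d / Real.log (1 + ε) * (1 / ((i : ℝ) + 1) ^ (1 + ε)) =
        (((i : ℝ) + 1) ^ (1 + ε) * (Real.log (1 + ε) / d))⁻¹ := by
      have : (0 : ℝ) < ((i : ℝ) + 1) ^ (1 + ε) := by positivity
      field_simp
    simp only [h4]
    gcongr
  have hsubset : {ω | ∃ k : ℕ, 1 ≤ k ∧ k * confWidth ε k d ≤ ∑ s ∈ Finset.range k, Y s ω} ⊆
      ⋃ i, B i := by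
    rintro ω ⟨k, hk, hkω⟩
    obtain ⟨i, hi, hi'⟩ := exists_nat_pow_near (x := (k : ℝ)) (by exact_mod_cast hk) hq
    exact Set.mem_iUnion.mpr ⟨i, k, Finset.mem_Icc.mpr ⟨hk, Nat.le_floor hi'.le⟩,
      (blockLevel_le hε hd hdε hk hi).trans hkω⟩
  rw [← tsum_mul_left]
  refine ENNReal.toReal_le_of_le_ofReal (tsum_nonneg hb0) ?_
  rw [ENNReal.ofReal_tsum_of_nonneg hb0 hsum]
  exact (measure_mono hsubset).trans ((measure_iUnion_le B).trans (ENNReal.tsum_le_tsum hBle))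

variable {n : ℕ}

/-- The confidence intervals fail at some arm and some number of pulls. -/
def confidenceFailure (I : GroupedBandit n) (ε δ : ℝ) (x : Fin n → ℕ → ℝ) : Prop :=
  ∃ j : Fin n, ∃ k : ℕ, 1 ≤ k ∧ confWidth ε k (δ / n) < |empMean x j k - I.mean j|

lemma measure_confidenceFailure_le {I : GroupedBandit n} {R : ℝ≥0} (hR : R ≤ 1 / 2)
    (hI : I.BoundedSubGaussian R) {ε δ : ℝ} (hε : 0 < ε) (hδ : 0 < δ)
    (hδε : δ ≤ Real.log (1 + ε)) {Ω : Type*} [MeasurableSpace Ω] {P : Measure Ω}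
    [IsProbabilityMeasure P] {X : Fin n → ℕ → Ω → ℝ} (hX : I.IsRewardTable P X) :
    P.real {ω | I.confidenceFailure ε δ fun j s => X j s ω} ≤
      2 * (δ / Real.log (1 + ε) * ∑' i : ℕ, 1 / ((i : ℝ) + 1) ^ (1 + ε)) := by
  set K : ℝ := ∑' i : ℕ, 1 / ((i : ℝ) + 1) ^ (1 + ε) with hK
  obtain rfl | hn := Nat.eq_zero_or_pos n
  · have hempty : {ω | I.confidenceFailure ε δ fun j s => X j s ω} = ∅ :=
      Set.eq_empty_of_forall_notMem fun ω ⟨j, _⟩ => j.elim0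
    have hK0 : 0 ≤ K := tsum_nonneg fun i => by positivity
    have : 0 < Real.log (1 + ε) := hδ.trans_le hδε
    rw [hempty, measureReal_empty]
    positivity
  have hn' : (1 : ℝ) ≤ n := by exact_mod_cast hn
  have hd : 0 < δ / n := by positivity
  have hdε : δ / n ≤ Real.log (1 + ε) := (div_le_self hδ.le hn').trans hδε
  have hsub : ∀ j s, HasSubgaussianMGF (fun ω => X j s ω - I.mean j) (1 / 4) P := by
    intro j s
    have h := hI.subGaussian j
    rw [← (hX.hasLaw j s).map_eq] at h
    have h' := h.of_map (hX.hasLaw j s).aemeasurable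
    refine ⟨h'.integrable_exp_mul, fun t => (h'.mgf_le t).trans (Real.exp_le_exp.mpr ?_)⟩
    have hR2 : R ^ 2 ≤ 1 / 4 := (pow_le_pow_left₀ zero_le hR 2).trans_eq (by norm_num)
    have : ((R ^ 2 : ℝ≥0) : ℝ) ≤ ((1 / 4 : ℝ≥0) : ℝ) := by exact_mod_cast hR2
    gcongr
  have hint : ∀ j s, Integrable (X j s) P := fun j s => by
    refine ((hsub j s).integrable.add (integrable_const (I.mean j))).congr ?_
    exact ae_of_all _ fun ω => sub_add_cancel _ _
  have hmean : ∀ j s, ∫ ω, (X j s ω - I.mean j) ∂P = 0 := by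
    intro j s
    rw [integral_sub (hint j s) (integrable_const _), (hX.hasLaw j s).integral_eq]
    simp [mean]
  have hindep : ∀ j, iIndepFun (fun s ω => X j s ω - I.mean j) P := fun j =>
    (hX.indep j).comp (fun _ x => x - I.mean j) fun _ => measurable_id.sub_const _
  have hindep' : ∀ j, iIndepFun (fun s ω => -(X j s ω - I.mean j)) P := fun j =>
    (hindep j).comp (fun _ x => -x) fun _ => measurable_neg
  set U := fun j => {ω | ∃ k : ℕ, 1 ≤ k ∧ k * confWidth ε k (δ / n) ≤
    ∑ s ∈ Finset.range k, (X j s ω - I.mean j)} with hU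
  set L := fun j => {ω | ∃ k : ℕ, 1 ≤ k ∧ k * confWidth ε k (δ / n) ≤
    ∑ s ∈ Finset.range k, -(X j s ω - I.mean j)} with hL
  have hUle : ∀ j, P.real (U j) ≤ δ / n / Real.log (1 + ε) * K := fun j =>
    measure_exists_confWidth_le hε hd hdε (hindep j) (hsub j) (hmean j)
  have hLle : ∀ j, P.real (L j) ≤ δ / n / Real.log (1 + ε) * K := fun j =>
    measure_exists_confWidth_le hε hd hdε (hindep' j) (fun s => (hsub j s).neg)
      (fun s => by rw [integral_neg, hmean j s, neg_zero])
  have hsubset : {ω | I.confidenceFailure ε δ fun j s => X j s ω} ⊆ ⋃ j, (U j ∪ L j) := by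
    rintro ω ⟨j, k, hk, hkω⟩
    refine Set.mem_iUnion.mpr ⟨j, ?_⟩
    have hk0 : (0 : ℝ) < k := by exact_mod_cast hk
    have hs : k * (empMean (fun j s => X j s ω) j k - I.mean j) =
        ∑ s ∈ Finset.range k, (X j s ω - I.mean j) := by
      rw [empMean, Finset.sum_sub_distrib, Finset.sum_const, Finset.card_range, nsmul_eq_mul]
      field_simp
    rcases lt_abs.mp hkω with h | h
    · refine Or.inl ⟨k, hk, ?_⟩
      rw [← hs]
      exact mul_le_mul_of_nonneg_left h.le hk0.le
    · refine Or.inr ⟨k, hk, ?_⟩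
      rw [Finset.sum_neg_distrib, ← hs, ← mul_neg]
      exact mul_le_mul_of_nonneg_left h.le hk0.le
  calc P.real {ω | I.confidenceFailure ε δ fun j s => X j s ω}
      ≤ P.real (⋃ j, (U j ∪ L j)) := measureReal_mono hsubset
    _ ≤ ∑ j, P.real (U j ∪ L j) := measureReal_iUnion_fintype_le _
    _ ≤ ∑ _j : Fin n, 2 * (δ / n / Real.log (1 + ε) * K) := by
        refine Finset.sum_le_sum fun j _ => (measureReal_union_le _ _).trans ?_
        linarith [hUle j, hLle j]
    _ = 2 * (δ / Real.log (1 + ε) * K) := by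
        rw [Finset.sum_const, Finset.card_univ, Fintype.card_fin, nsmul_eq_mul]
        field_simp

end GroupedBandit

namespace GroupedBandit

variable {n : ℕ}

lemma pulls_succ (a : ℕ → Fin n) (t : ℕ) (j : Fin n) :
    pulls a (t + 1) j = pulls a t j + if a (t + 1) = j then 1 else 0 := by
  rw [pulls, pulls, ← Finset.insert_Icc_right_eq_Icc_add_one (by omega), Finset.filter_insert]
  split_ifs
  · rw [Finset.card_insert_of_notMem (by simp)]
  · rfl

lemma sum_pulls (a : ℕ → Fin n) (T : ℕ) : ∑ j, pulls a T j = T := by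
  have h := Finset.card_eq_sum_card_fiberwise (s := Finset.Icc 1 T) (t := Finset.univ) (f := a)
    fun _ _ => Finset.mem_coe.mpr (Finset.mem_univ _)
  rw [Nat.card_Icc, Nat.add_sub_cancel] at h
  exact h.symm

lemma exists_pulls_eq_add_one {a : ℕ → Fin n} {T : ℕ} {j : Fin n} (h : 0 < pulls a T j) :
    ∃ t ∈ Finset.Icc 1 T, a t = j ∧ pulls a T j = pulls a (t - 1) j + 1 := by
  induction T with
  | zero => simp [pulls] at h
  | succ T ih =>
    by_cases hj : a (T + 1) = j
    · exact ⟨T + 1, by simp, hj, by rw [pulls_succ, if_pos hj, Nat.add_sub_cancel]⟩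
    · rw [pulls_succ, if_neg hj, add_zero] at h ⊢
      obtain ⟨t, ht, h1⟩ := ih h
      exact ⟨t, Finset.Icc_subset_Icc_right (Nat.le_succ T) ht, h1⟩

lemma exists_round_many_pulls (a : ℕ → Fin n) {T : ℕ} (hT : 1 ≤ T) :
    ∃ t ∈ Finset.Icc 1 T, T ≤ n * (pulls a (t - 1) (a t) + 1) := by
  have hn : (Finset.univ : Finset (Fin n)).Nonempty := ⟨a 0, Finset.mem_univ _⟩
  obtain ⟨j, -, hj⟩ := Finset.exists_max_image Finset.univ (pulls a T) hn
  have hle : T ≤ n * pulls a T j := by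
    conv_lhs => rw [← sum_pulls a T]
    refine (Finset.sum_le_card_nsmul _ _ _ hj).trans_eq ?_
    simp
  have hpos : 0 < pulls a T j := Nat.pos_of_ne_zero fun h => by
    rw [h] at hle
    omega
  obtain ⟨t, ht, rfl, h⟩ := exists_pulls_eq_add_one hpos
  exact ⟨t, ht, h ▸ hle⟩

section Deterministic

variable {I : GroupedBandit n} {ε δ : ℝ} {x : Fin n → ℕ → ℝ} {a : ℕ → Fin n}

lemma groupMin_le (f : Fin n → ℝ) {G : I.Group} {j : Fin n} (hj : j ∈ G.1) :
    I.groupMin f G ≤ f j :=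
  Finset.inf'_le f hj

lemma le_groupMin {f : Fin n → ℝ} {G : I.Group} {b : ℝ} (h : ∀ j ∈ G.1, b ≤ f j) :
    b ≤ I.groupMin f G :=
  Finset.le_inf' _ _ h

lemma groupMin_mono {f f' : Fin n → ℝ} (h : ∀ j, f j ≤ f' j) (G : I.Group) :
    I.groupMin f G ≤ I.groupMin f' G :=
  le_groupMin fun j hj => (groupMin_le f hj).trans (h j)

lemma worstMean_mem_Icc (h : ∀ j, I.mean j ∈ Set.Icc (0 : ℝ) 1) (G : I.Group) :
    I.worstMean G ∈ Set.Icc (0 : ℝ) 1 := by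
  obtain ⟨j, hj⟩ := I.nonempty_of_mem G.2
  exact ⟨le_groupMin fun j _ => (h j).1, (groupMin_le _ hj).trans (h j).2⟩

lemma abs_empMean_sub_mean_le (hgood : ¬ I.confidenceFailure ε δ x) (j : Fin n) {k : ℕ}
    (hk : 1 ≤ k) : |empMean x j k - I.mean j| ≤ confWidth ε k (δ / n) :=
  not_lt.mp fun h => hgood ⟨j, k, hk, h⟩

lemma lcb_le_mean (hgood : ¬ I.confidenceFailure ε δ x) {j : Fin n} (h0 : 0 ≤ I.mean j) (t : ℕ) :
    lcb ε δ x a t j ≤ I.mean j := by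
  rw [lcb]
  split_ifs with h
  · exact h0
  · linarith [(abs_le.mp (abs_empMean_sub_mean_le hgood j (Nat.one_le_iff_ne_zero.mpr h))).2]

lemma mean_le_ucb (hgood : ¬ I.confidenceFailure ε δ x) {j : Fin n} (h1 : I.mean j ≤ 1) (t : ℕ) :
    I.mean j ≤ ucb ε δ x a t j := by
  rw [ucb]
  split_ifs with h
  · exact h1
  · linarith [(abs_le.mp (abs_empMean_sub_mean_le hgood j (Nat.one_le_iff_ne_zero.mpr h))).1]

lemma ucb_eq_lcb_add {t : ℕ} {j : Fin n} (h : pulls a t j ≠ 0) :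
    ucb ε δ x a t j = lcb ε δ x a t j + 2 * confWidth ε (pulls a t j) (δ / n) := by
  rw [ucb, lcb, if_neg h, if_neg h]
  ring

lemma le_gapOne_iff {d : ℝ} {j : Fin n} :
    (d : EReal) ≤ I.gapOne j ↔ ∀ G : I.Group, j ∈ G.1 → d ≤ I.mean j - I.worstMean G := by
  simp only [gapOne, le_iInf_iff, EReal.coe_le_coe_iff, Subtype.forall]

lemma le_gapTwo_iff {d : ℝ} {Gstar : I.Group} {j : Fin n} :
    (d : EReal) ≤ I.gapTwo Gstar j ↔
      ∀ G : I.Group, j ∈ G.1 → d ≤ I.worstMean Gstar - I.worstMean G := by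
  simp only [gapTwo, groupGap, le_iInf_iff, EReal.coe_le_coe_iff, Subtype.forall]

lemma le_gapZero_iff {d : ℝ} {Gstar : I.Group} :
    (d : EReal) ≤ I.gapZero Gstar ↔
      ∀ G : I.Group, G ≠ Gstar → d ≤ I.worstMean Gstar - I.worstMean G := by
  simp only [gapZero, groupGap, le_iInf_iff, EReal.coe_le_coe_iff, Subtype.forall]

lemma le_gap_iff {d : ℝ} {Gstar : I.Group} {j : Fin n} :
    (d : EReal) ≤ I.gap Gstar j ↔
      (∀ G : I.Group, j ∈ G.1 → d ≤ I.mean j - I.worstMean G) ∨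
      (∀ G : I.Group, j ∈ G.1 → d ≤ I.worstMean Gstar - I.worstMean G) ∨
      (∀ G : I.Group, G ≠ Gstar → d ≤ I.worstMean Gstar - I.worstMean G) := by
  rw [gap, le_max_iff, le_max_iff, le_gapOne_iff, le_gapTwo_iff, le_gapZero_iff, or_assoc]

lemma gap_lower_bound_le_one {d : ℝ} {G Gstar : I.Group} (hG : G ≠ Gstar)
    (hmean : ∀ j, I.mean j ∈ Set.Icc (0 : ℝ) 1)
    (hgap : ∀ j, (d : EReal) ≤ I.gap Gstar j) : d ≤ 1 := by
  obtain ⟨j, hj⟩ := I.nonempty_of_mem G.2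
  have h1 := (hmean j).2
  have h2 := (worstMean_mem_Icc hmean G).1
  have h3 := (worstMean_mem_Icc hmean Gstar).2
  rcases le_gap_iff.mp (hgap j) with h | h | h
  · linarith [h G hj]
  · linarith [h G hj]
  · linarith [h G hG]

/-- On the good event, a round that pulls an arm whose confidence interval is shorter than its gap
certifies that its group beats all groups other than `Gstar`. -/
lemma worstMean_lt_groupMin_lcb {Gstar : I.Group} {d : ℝ} {T t : ℕ} {g : ℕ → I.Group}
    (hgood : ¬ I.confidenceFailure ε δ x) (hmean : ∀ j, I.mean j ∈ Set.Icc (0 : ℝ) 1)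
    (hrun : I.IsStableOptRun ε δ x T g a) (ht : t ∈ Finset.Icc 1 T)
    (hgap : (d : EReal) ≤ I.gap Gstar (a t)) (hpull : pulls a (t - 1) (a t) ≠ 0)
    (hwidth : 2 * confWidth ε (pulls a (t - 1) (a t)) (δ / n) < d)
    {G : I.Group} (hG : G ≠ Gstar) :
    I.worstMean G < I.groupMin (lcb ε δ x a (t - 1)) (g t) := by
  have hmem := hrun.arm_mem t ht
  have hlcb : lcb ε δ x a (t - 1) (a t) ≤ I.groupMin (lcb ε δ x a (t - 1)) (g t) :=
    le_groupMin fun j hj => hrun.arm_argmin t ht j hj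
  have hworst : I.groupMin (lcb ε δ x a (t - 1)) (g t) ≤ I.worstMean (g t) :=
    groupMin_mono (fun j => lcb_le_mean hgood (hmean j).1 _) _
  have hstar : I.worstMean Gstar ≤ ucb ε δ x a (t - 1) (a t) :=
    (groupMin_mono (fun j => mean_le_ucb hgood (hmean j).2 _) _).trans
      ((hrun.group_argmax t ht Gstar).trans (groupMin_le _ hmem))
  have hucb := mean_le_ucb (a := a) hgood (hmean (a t)).2 (t - 1)
  rw [ucb_eq_lcb_add hpull] at hstar hucb
  rcases le_gap_iff.mp hgap with h | h | h
  · linarith [h _ hmem]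
  · linarith [h _ hmem]
  · linarith [h G hG]

lemma IsStableOptOutput.eq_of_not_confidenceFailure {Gstar G : I.Group} {d : ℝ} {T : ℕ}
    (hgood : ¬ I.confidenceFailure ε δ x) (hmean : ∀ j, I.mean j ∈ Set.Icc (0 : ℝ) 1)
    (hgap : ∀ j, (d : EReal) ≤ I.gap Gstar j)
    (hT : ∀ k : ℕ, T ≤ n * (k + 1) → k ≠ 0 ∧ 2 * confWidth ε k (δ / n) < d)
    (hout : I.IsStableOptOutput ε δ x T G) : G = Gstar := by
  obtain ⟨g, a, hrun, s, hs, hmax, rfl⟩ := hout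
  have hs' := Finset.mem_Icc.mp hs
  obtain ⟨t, ht, hle⟩ := exists_round_many_pulls a (hs'.1.trans hs'.2)
  obtain ⟨hpull, hwidth⟩ := hT _ hle
  by_contra hne
  have h1 := worstMean_lt_groupMin_lcb hgood hmean hrun ht (hgap _) hpull hwidth hne
  have h2 : I.groupMin (lcb ε δ x a (s - 1)) (g s) ≤ I.worstMean (g s) :=
    groupMin_mono (fun j => lcb_le_mean hgood (hmean j).1 _) _
  linarith [hmax t ht]

end Deterministic

lemma two_mul_confWidth_lt_of_log_le {ε d e V : ℝ} (hε : ε ∈ Set.Ioo (0 : ℝ) 1) {k : ℕ}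
    (hk : (0 : ℝ) < k) (hd : 0 < d) (hV : 0 < V)
    (hW : Real.log (Real.log ((1 + ε) * k) / e) ≤ V) (hkey : 16 * V < d ^ 2 * k) :
    2 * confWidth ε k e < d := by
  have hsqrt : √((1 + ε) / (2 * k) * Real.log (Real.log ((1 + ε) * k) / e)) < d / 4 := by
    rw [Real.sqrt_lt' (by positivity)]
    have h1 : (1 + ε) / (2 * k) * Real.log (Real.log ((1 + ε) * k) / e) ≤
        (1 + 1) / (2 * k) * V := by
      have h0 := hε.1
      have h2 := hε.2
      exact (mul_le_mul_of_nonneg_left hW (by positivity)).trans (by gcongr)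
    refine h1.trans_lt ?_
    rw [div_mul_eq_mul_div, div_lt_iff₀ (by positivity)]
    linarith
  have hsqrtε : √ε ≤ 1 := Real.sqrt_le_one.mpr hε.2.le
  rw [confWidth]
  have := mul_le_mul_of_nonneg_right (show 1 + √ε ≤ 2 by linarith)
    (Real.sqrt_nonneg ((1 + ε) / (2 * k) * Real.log (Real.log ((1 + ε) * k) / e)))
  linarith

lemma two_mul_confWidth_lt {n : ℕ} (hn : 0 < n) {ε δ d : ℝ} (hε : ε ∈ Set.Ioo (0 : ℝ) 1)
    (hδ : 0 < δ) (hL : 1 ≤ Real.log (n / δ)) (hd : 0 < d) (hd1 : d ≤ 1) {T k : ℕ}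
    (hT : Real.exp 8 * mulLogLog (n * Real.log (n / δ) / d ^ 2) ≤ T) (hk : T ≤ n * (k + 1)) :
    k ≠ 0 ∧ 2 * confWidth ε k (δ / n) < d := by
  have hn' : (1 : ℝ) ≤ n := by exact_mod_cast hn
  set L := Real.log (n / δ) with hLdef
  set A := n * L / d ^ 2 with hA
  set M := max (Real.exp 1) (Real.log A) with hM
  set l := Real.log M with hl
  have he8 : 400 < Real.exp 8 := by
    have h1 : (2.7 : ℝ) ^ 8 ≤ Real.exp 1 ^ 8 :=
      pow_le_pow_left₀ (by norm_num) (by linarith [Real.exp_one_gt_d9]) 8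
    rw [← Real.exp_nat_mul] at h1
    norm_num at h1 ⊢
    linarith
  have hM1 : Real.exp 1 ≤ M := le_max_left _ _
  have hMpos : 0 < M := (Real.exp_pos 1).trans_le hM1
  have hM2 : 1 ≤ M := (Real.one_le_exp zero_le_one).trans hM1
  have hl1 : 1 ≤ l := by
    rw [hl, Real.le_log_iff_exp_le hMpos]
    exact hM1
  have hd2 : d ^ 2 ≤ 1 := pow_le_one₀ hd.le hd1
  have hLl : 1 ≤ L * l := one_le_mul_of_one_le_of_one_le hL hl1
  set w := Real.exp 8 * (L * l) / d ^ 2 with hw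
  have hw4 : 400 ≤ w := by
    rw [hw, le_div_iff₀ (by positivity)]
    nlinarith
  have hk1 : w ≤ k + 1 := by
    have h1 : (T : ℝ) ≤ n * (k + 1) := by exact_mod_cast hk
    have h2 : n * w ≤ n * ((k : ℝ) + 1) := by
      refine le_trans (le_of_eq ?_) (hT.trans h1)
      rw [mulLogLog, hw, ← hM, ← hl, hA]
      ring
    exact le_of_mul_le_mul_left h2 (by linarith)
  have hk0 : (0 : ℝ) < k := by linarith
  have hk1' : (1 : ℝ) ≤ k := by linarith
  refine ⟨fun h => by simp [h] at hk0, ?_⟩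
  set s := 2 * k / w with hs
  have hs1 : 1 ≤ s := by
    rw [hs, one_le_div (by linarith)]
    linarith
  have h2k : 2 * (k : ℝ) = s * w := by
    rw [hs, div_mul_cancel₀]
    linarith
  have hApos : 0 < A := by positivity
  have hlog2k : Real.log (2 * k) ≤ 11 * (M * s) := by
    have h1 : 2 * (k : ℝ) ≤ s * (Real.exp 8 * (A * l)) := by
      rw [h2k, hw, hA]
      have : L * l / d ^ 2 ≤ n * (L * l / d ^ 2) := le_mul_of_one_le_left (by positivity) hn'
      calc s * (Real.exp 8 * (L * l) / d ^ 2) = s * (Real.exp 8 * (L * l / d ^ 2)) := by ring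
        _ ≤ s * (Real.exp 8 * (n * (L * l / d ^ 2))) := by gcongr
        _ = _ := by ring
    have h2 := Real.log_le_log (by linarith) h1
    have h7 : Real.log (s * (Real.exp 8 * (A * l))) =
        Real.log s + (8 + (Real.log A + Real.log l)) := by
      rw [Real.log_mul (by positivity) (by positivity),
        Real.log_mul (by positivity) (by positivity),
        Real.log_mul (by positivity) (by positivity), Real.log_exp]
    have h3 : Real.log A ≤ M := le_max_right _ _
    have h4 : Real.log l ≤ l - 1 := Real.log_le_sub_one_of_pos (by linarith)
    have h5 : l ≤ M - 1 := Real.log_le_sub_one_of_pos hMpos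
    have h6 : Real.log s ≤ s - 1 := Real.log_le_sub_one_of_pos (by linarith)
    have h8 : M ≤ M * s := le_mul_of_one_le_right hMpos.le hs1
    have h9 : s ≤ M * s := le_mul_of_one_le_left (by linarith) hM2
    linarith
  have hlogpos : 0 < Real.log ((1 + ε) * k) := Real.log_pos (by nlinarith [hε.1])
  have hloglog : Real.log (Real.log ((1 + ε) * k)) ≤ 11 * (s * l) := by
    have h1 : Real.log ((1 + ε) * k) ≤ 11 * (M * s) :=
      (Real.log_le_log (by nlinarith [hε.1])
        (mul_le_mul_of_nonneg_right (by linarith [hε.2]) hk0.le)).trans hlog2k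
    have h2 := Real.log_le_log hlogpos h1
    have h5 : Real.log (11 * (M * s)) = Real.log 11 + (l + Real.log s) := by
      rw [Real.log_mul (by norm_num) (by positivity), Real.log_mul (by positivity) (by positivity)]
    have h3 : Real.log 11 ≤ 11 - 1 := Real.log_le_sub_one_of_pos (by norm_num)
    have h4 : Real.log s ≤ s - 1 := Real.log_le_sub_one_of_pos (by linarith)
    have h6 : l ≤ s * l := le_mul_of_one_le_left (by linarith) hs1
    have h7 : s ≤ s * l := le_mul_of_one_le_right (by linarith) hl1
    linarith
  set V := L + 11 * (s * l) with hV
  have hVpos : 0 < V := by positivity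
  have hW : Real.log (Real.log ((1 + ε) * k) / (δ / n)) ≤ V := by
    have : Real.log ((1 + ε) * k) / (δ / n) = Real.log ((1 + ε) * k) * (n / δ) := by
      field_simp
    rw [this, Real.log_mul hlogpos.ne' (by positivity)]
    linarith
  have hkey : 16 * V < d ^ 2 * k := by
    have h1 : d ^ 2 * k = Real.exp 8 / 2 * (s * (L * l)) := by
      have : d ^ 2 * (2 * k) = s * (Real.exp 8 * (L * l)) := by
        rw [h2k, hw]
        field_simp
      linarith
    have h2 : L ≤ s * (L * l) := (le_mul_of_one_le_right (by linarith) hl1).trans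
      (le_mul_of_one_le_left (by positivity) hs1)
    have h3 : s * l ≤ s * (L * l) := mul_le_mul_of_nonneg_left
      (le_mul_of_one_le_left (by linarith) hL) (by linarith)
    have h4 : 0 < s * (L * l) := by positivity
    have h5 : 200 * (s * (L * l)) < Real.exp 8 / 2 * (s * (L * l)) :=
      mul_lt_mul_of_pos_right (by linarith) h4
    rw [h1, hV]
    linarith
  exact two_mul_confWidth_lt_of_log_le hε hk0 hd hVpos hW hkey

end GroupedBandit

open GroupedBandit in
theorem mainTheorem3 (ε : ℝ) (hε : ε ∈ Set.Ioo (0 : ℝ) 1) :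
    ∃ C : ℝ, 0 < C ∧ ∃ c : ℝ, 0 < c ∧
      ∀ (n : ℕ) (I : GroupedBandit n) (R : ℝ≥0), R ≤ 1 / 2 → I.BoundedSubGaussian R →
      ∀ Gstar : I.Group, I.IsUniqueOptimal Gstar →
      ∀ Δmin : ℝ, 0 < Δmin → (∀ j : Fin n, (Δmin : EReal) ≤ I.gap Gstar j) →
      ∀ δ : ℝ, δ ∈ Set.Ioo (0 : ℝ) (Real.log 2 / Real.exp 1) →
      ∀ T : ℕ, c * mulLogLog ((n : ℝ) * Real.log ((n : ℝ) / δ) / Δmin ^ 2) ≤ (T : ℝ) →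
      ∀ (Ω : Type*) [MeasurableSpace Ω] (P : Measure Ω) [IsProbabilityMeasure P]
        (X : Fin n → ℕ → Ω → ℝ), I.IsRewardTable P X →
      ∀ out : Ω → I.Group,
        (∀ ω, I.IsStableOptOutput ε δ (fun j s => X j s ω) T (out ω)) →
        P.real {ω | out ω ≠ Gstar} ≤ C * δ := by
  have ha : 0 < Real.log (1 + ε) := Real.log_pos (by linarith [hε.1])
  set K : ℝ := ∑' i : ℕ, 1 / ((i : ℝ) + 1) ^ (1 + ε) with hK
  have hK0 : 0 ≤ K := tsum_nonneg fun i => by positivity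
  refine ⟨(1 + 2 * K) / Real.log (1 + ε), by positivity, Real.exp 8, Real.exp_pos 8, ?_⟩
  intro n I R hR hI Gstar _ Δmin hΔ hgap δ hδ T hT Ω _ P _ X hX out hout
  rcases lt_or_ge (Real.log (1 + ε)) δ with hδε | hδε
  · refine measureReal_le_one.trans ?_
    rw [div_mul_eq_mul_div, one_le_div ha]
    nlinarith
  have hn : 0 < n := by
    obtain ⟨j, _⟩ := I.nonempty_of_mem Gstar.2
    exact j.pos
  have hn' : (1 : ℝ) ≤ n := by exact_mod_cast hn
  have hL : 1 ≤ Real.log (n / δ) := by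
    have hδ0 := hδ.1
    rw [Real.le_log_iff_exp_le (by positivity), le_div_iff₀ hδ0]
    have h1 := (lt_div_iff₀ (Real.exp_pos 1)).mp hδ.2
    linarith [Real.log_two_lt_d9]
  have hsubset : {ω | out ω ≠ Gstar} ⊆ {ω | I.confidenceFailure ε δ fun j s => X j s ω} := by
    intro ω hω
    by_contra hgood
    exact hω ((hout ω).eq_of_not_confidenceFailure hgood hI.mean_mem hgap fun k hk =>
      two_mul_confWidth_lt hn hε hδ.1 hL hΔ (gap_lower_bound_le_one hω hI.mean_mem hgap) hT hk)
  calc P.real {ω | out ω ≠ Gstar}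
      ≤ P.real {ω | I.confidenceFailure ε δ fun j s => X j s ω} := measureReal_mono hsubset
    _ ≤ 2 * (δ / Real.log (1 + ε) * K) :=
        measure_confidenceFailure_le hR hI hε.1 hδ.1 hδε hX
    _ ≤ (1 + 2 * K) / Real.log (1 + ε) * δ := by
        have : (1 + 2 * K) / Real.log (1 + ε) * δ =
            2 * (δ / Real.log (1 + ε) * K) + δ / Real.log (1 + ε) := by ring
        rw [this]
        exact le_add_of_nonneg_right (div_nonneg hδ.1.le ha.le)
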